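/- Let $n\ge 0$ and $k\ge 0$ be integers. A parking preference of length $n$ is a sequence $(a_1,\dots,a_n)$ with entries in $\{1,\dots,n\}$. Cars $c_1,\dots,c_n$ arrive in this order on a one-way street with spots $1,\dots,n$, all empty at the beginning. Car $c_i$ parks in spot $a_i$ if it is free; otherwise it checks the spots $a_i-1,a_i-2,\dots,a_i-k$ in this order (only those that are at least $1$) and parks in the first free one; if none of these is free, it parks in the first free spot among $a_i+1,\dots,n$, and it fails to park if there is none. The preference is a $k$-Naples parking function if all cars can park, and it is ascending if $a_1\le a_2\le\dots\le a_n$. Let $I_{n,k}$ be the number of ascending $k$-Naples parking functions of length $n$, and let $U_{n,k}$ be the number of those with $a_1=1$; in particular $I_{0,k}=1$ (the empty sequence) and $U_{0,k}=0$. Let $C_k=\frac1{k+1}\binom{2k}{k}$ be the $k$th Catalan number. Then for all integers $k\ge 1$ and $n\ge 0$ (in particular, whenever $n-1\ge k\ge1$), $$I_{n,k}=I_{n,k-1}+C_k\sum_{i=0}^{n-k} I_{i,k-1}\,U_{n-k-i,k}$$ and $$U_{n,k}=U_{n,k-1}+C_k\sum_{i=0}^{n-k} U_{i,k-1}\,U_{n-k-i,k},$$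 where the sums are empty, hence $0$, if $n<k$. -/

import Mathlib

namespace Naples

/-- The spots inspected by a car with preference `p` on a street with spots `1, …, n`, in the order
in which the `k`-Naples rule inspects them: the preferred spot `p`, then the spots
`p - 1, p - 2, …, p - k` (only those that exist, i.e. are at least `1`; the truncated differences
equal to `0` are filtered out), and then, moving forward, `p + 1, …, n`. -/
def candidates (n k p : ℕ) : List ℕ :=
  ((List.range (k + 1)).map (fun j => p - j)).filter (fun s => 1 ≤ s) ++ List.range' (p + 1) (n - p)

/-- The spot taken by a car with preference `p` when the spots in `occ` are already occupied: the
first unoccupied spot that it inspects, and `none` if there is no such spot. -/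
def parkSpot (n k : ℕ) (occ : Finset ℕ) (p : ℕ) : Option ℕ :=
  (candidates n k p).find? (fun s => s ∉ occ)

/-- The cars with preferences given by the list arrive one after the other, the spots in `occ` being
occupied at the beginning. The result is the list of the spots in which they park, or `none` if some
car is unable to park. -/
def outcome (n k : ℕ) : Finset ℕ → List ℕ → Option (List ℕ)
  | _, [] => some []
  | occ, p :: a =>
      (parkSpot n k occ p).bind fun d => (outcome n k (insert d occ) a).map fun ds => d :: ds

/-- `a = (a₁, …, aₙ)` is a parking preference of length `n`: a sequence of length `n` with entries
in `{1, …, n}`. -/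
def IsPreference (n : ℕ) (a : List ℕ) : Prop :=
  a.length = n ∧ ∀ p ∈ a, 1 ≤ p ∧ p ≤ n

/-- `a` is a `k`-Naples parking function of length `n`: a parking preference of length `n` for which
all cars can park by the `k`-Naples rule, on a street which is empty at the beginning. -/
def IsNaples (n k : ℕ) (a : List ℕ) : Prop :=
  IsPreference n a ∧ (outcome n k ∅ a).isSome

/-- The set of ascending (weakly increasing) `k`-Naples parking functions of length `n`. -/
def ascending (n k : ℕ) : Set (List ℕ) :=
  {a | IsNaples n k a ∧ a.Pairwise (· ≤ ·)}

/-- The set of ascending `k`-Naples parking functions of length `n` whose first entry is `1`. -/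
def ascendingOne (n k : ℕ) : Set (List ℕ) :=
  {a | a ∈ ascending n k ∧ a.head? = some 1}

theorem finite_ascending (n k : ℕ) : (ascending n k).Finite := by
  refine ((List.finite_length_eq (Fin (n + 1)) n).image (List.map Fin.val)).subset ?_
  rintro a ⟨⟨⟨hl, hp⟩, -⟩, -⟩
  refine ⟨a.map (Fin.ofNat (n + 1)), by simpa using hl, ?_⟩
  rw [List.map_map]
  conv_rhs => rw [← List.map_id a]
  refine List.map_congr_left fun p h => ?_
  simpa [Fin.ofNat] using Nat.lt_succ_of_le (hp p h).2

theorem finite_ascendingOne (n k : ℕ) : (ascendingOne n k).Finite :=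
  (finite_ascending n k).subset fun _ h => h.1

/-- `I_{n,k}`: the number of ascending `k`-Naples parking functions of length `n`. -/
noncomputable def numAscending (n k : ℕ) : ℕ := (ascending n k).ncard

/-- `U_{n,k}`: the number of ascending `k`-Naples parking functions of length `n` that start
with `1`. -/
noncomputable def numAscendingOne (n k : ℕ) : ℕ := (ascendingOne n k).ncard

end Naples

/-!
An ascending preference of length `n` is read as a lattice path: from left to right, an up step for
each car that prefers the current spot, and then a down step for the spot. The path is balanced and
ends with a down step, so it splits uniquely into blocks, each consisting of a (possibly empty) Dyck
path below the axis followed by one arch above the axis (`exists_word_eq`, `word_injective`). Both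
Dyck paths of a block are encoded by binary trees, with the semilength as the number of nodes.

Suppose that the spots up to `q` are occupied when a block starts, and let `s` be the semilength of
its path below the axis. If `s ≤ k`, then each car of this path backs up to the last free spot that
was passed, so spot `q + 1` is the only one left free (`run_excursion_false`); the first car of the
arch prefers spot `q + 1 + s` and backs up to `q + 1`, and the other cars of the arch take one spot
after the other going forward (`run_excursion_true`). If `s > k`, then some free spot gets out of
reach of all later cars (`exists_notMem_run_excursion_false`), so some car fails to park. Hence the
preference is `k`-Naples if and only if all its paths below the axis have semilength at most `k`
(`isSome_run_word`), and it starts with `1` if and only if the first of these paths is empty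
(`head?_cars_word`).

With the generating functions `C` of all Catalan numbers and `D_k` of the Catalan numbers up to
`C_k`, this gives `I_k = 1 + x D_k C I_k` and `U_k = x C I_k` (`ascendingSeries_eq`,
`ascendingOneSeries_eq`). As `D_k - D_{k-1} = C_k x^k`, multiplying the equation of `I_k` by
`I_{k-1}`, that of `I_{k-1}` by `I_k`, and subtracting gives `I_k - I_{k-1} = C_k x^k I_{k-1} U_k`;
multiplying by `x C` gives the second recurrence.
-/

namespace Naples

open BinaryTree Finset.HasAntidiagonal

/-! ### Words of cars and spots -/

/-- A street and an ascending preference, read from left to right, form a word: for each spot, one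
letter `true` per car that prefers it, and then one letter `false`. `cars c w` is the list of
preferences encoded by `w` if the first spot has number `c`. -/
def cars : ℕ → List Bool → List ℕ
  | _, [] => []
  | c, true :: w => c :: cars c w
  | c, false :: w => cars (c + 1) w

theorem cars_append (v w : List Bool) (c : ℕ) :
    cars c (v ++ w) = cars c v ++ cars (c + v.count false) w := by
  induction v generalizing c with
  | nil => simp [cars]
  | cons b v ih =>
    cases b
    · simp [cars, ih, add_comm, add_left_comm]
    · simp [cars, ih]

theorem length_cars (w : List Bool) (c : ℕ) : (cars c w).length = w.count true := by
  induction w generalizing c with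
  | nil => simp [cars]
  | cons b w ih => cases b <;> simp [cars, ih]

theorem le_of_mem_cars {w : List Bool} {c p : ℕ} (h : p ∈ cars c w) : c ≤ p := by
  induction w generalizing c with
  | nil => simp [cars] at h
  | cons b w ih =>
    cases b
    · exact (Nat.le_succ c).trans (ih h)
    · rcases List.mem_cons.1 h with rfl | h
      · exact le_rfl
      · exact ih h

theorem le_add_count_of_mem_cars {w : List Bool} {c p : ℕ} (h : p ∈ cars c w) :
    p ≤ c + w.count false := by
  induction w generalizing c with
  | nil => simp [cars] at h
  | cons b w ih =>
    cases b
    · have := ih (c := c + 1) h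
      simp only [List.count_cons_self]
      omega
    · rcases List.mem_cons.1 h with rfl | h
      · exact Nat.le_add_right _ _
      · simpa using ih h

theorem pairwise_cars (w : List Bool) (c : ℕ) : (cars c w).Pairwise (· ≤ ·) := by
  induction w generalizing c with
  | nil => simp [cars]
  | cons b w ih =>
    cases b
    · exact ih (c + 1)
    · exact List.pairwise_cons.2 ⟨fun p hp => le_of_mem_cars hp, ih c⟩

/-- A list of preferences and the number of spots determine the word. -/
theorem cars_injective {v w : List Bool} {c : ℕ} (h : cars c v = cars c w)
    (hc : v.count false = w.count false) : v = w := by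
  induction v generalizing c w with
  | nil =>
    match w with
    | [] => rfl
    | true :: w => simp [cars] at h
    | false :: w => simp at hc
  | cons b v ih =>
    match b, w with
    | true, [] => simp [cars] at h
    | false, [] => simp at hc
    | true, true :: w =>
      simp only [cars, List.cons.injEq, true_and] at h
      rw [ih h (by simpa using hc)]
    | false, false :: w => rw [ih (c := c + 1) h (by simpa using hc)]
    | true, false :: w =>
      have : c ∈ cars (c + 1) w := by
        change c :: cars c v = cars (c + 1) w at h
        simp [← h]
      exact absurd (le_of_mem_cars this) (by omega)
    | false, true :: w =>
      have : c ∈ cars (c + 1) v := by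
        change cars (c + 1) v = c :: cars c w at h
        simp [h]
      exact absurd (le_of_mem_cars this) (by omega)

/-- Every ascending list of preferences for the spots `c, …, c + m` comes from a word that ends with
the letter `false` of its last spot. -/
theorem exists_cars_eq (m : ℕ) (c : ℕ) (a : List ℕ) (ha : a.Pairwise (· ≤ ·))
    (hm : ∀ p ∈ a, c ≤ p ∧ p ≤ c + m) :
    ∃ w : List Bool, cars c (w ++ [false]) = a ∧ w.count false = m := by
  induction m generalizing c a with
  | zero =>
    induction a with
    | nil => exact ⟨[], rfl, rfl⟩
    | cons p a ih =>
      obtain ⟨w, hw, hc⟩ := ih ha.of_cons fun q hq => hm q (List.mem_cons_of_mem _ hq)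
      obtain rfl : c = p := le_antisymm (hm p (by simp)).1 (hm p (by simp)).2
      exact ⟨true :: w, by simp [cars, hw], by simpa using hc⟩
  | succ m ih =>
    induction a with
    | nil =>
      obtain ⟨w, hw, hc⟩ := ih (c + 1) [] List.Pairwise.nil (by simp)
      exact ⟨false :: w, hw, by simpa using hc⟩
    | cons p a iha =>
      rcases (hm p (by simp)).1.eq_or_lt with rfl | hp
      · obtain ⟨w, hw, hc⟩ := iha ha.of_cons fun q hq => hm q (List.mem_cons_of_mem _ hq)
        exact ⟨true :: w, by simp [cars, hw], by simpa using hc⟩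
      · obtain ⟨w, hw, hc⟩ := ih (c + 1) (p :: a) ha fun q hq => by
          have h1 := hm q hq
          rcases List.mem_cons.1 hq with rfl | hq
          · omega
          · have := List.rel_of_pairwise_cons ha hq
            omega
        exact ⟨false :: w, hw, by simpa using hc⟩

/-! ### Dyck words and the decomposition into blocks -/

/-- The Dyck word of a binary tree, with `b` as the up step and `!b` as the down step. -/
def excursion (b : Bool) : BinaryTree Unit → List Bool
  | nil => []
  | node _ l r => b :: (excursion b l ++ (!b) :: excursion b r)

theorem count_excursion (b x : Bool) (t : BinaryTree Unit) :
    (excursion b t).count x = t.numNodes := by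
  induction t with
  | nil => rfl
  | node a l r hl hr =>
    simp only [excursion, List.count_cons, List.count_append, hl, hr, numNodes]
    cases b <;> cases x <;> simp <;> omega

/-- A Dyck word is determined by any word in which it is followed by a down step: it ends where the
word first gets below the level at which it starts. -/
theorem excursion_append_inj {b : Bool} {t t' : BinaryTree Unit} {r r' : List Bool}
    (h : excursion b t ++ (!b) :: r = excursion b t' ++ (!b) :: r') : t = t' ∧ r = r' := by
  induction t generalizing t' r r' with
  | nil =>
    cases t' with
    | nil => simpa [excursion] using h
    | node a u v => cases b <;> simp [excursion] at h
  | node a u v hu hv =>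
    cases t' with
    | nil => cases b <;> simp [excursion] at h
    | node a' u' v' =>
      simp only [excursion, List.cons_append, List.append_assoc, List.cons.injEq, true_and] at h
      obtain ⟨rfl, h'⟩ := hu h
      obtain ⟨rfl, rfl⟩ := hv h'
      exact ⟨rfl, rfl⟩

/-- First passage decomposition: a word with more down steps than up steps starts with a Dyck word
and a down step. -/
theorem exists_excursion_append {b : Bool} (w : List Bool) (h : w.count b < w.count (!b)) :
    ∃ t r, w = excursion b t ++ (!b) :: r := by
  induction hn : w.length using Nat.strong_induction_on generalizing w with
  | _ n ih =>
    subst hn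
    match w with
    | [] => simp at h
    | x :: w =>
      obtain rfl | rfl : x = b ∨ x = !b := by cases x <;> cases b <;> simp
      · have h1 : w.count x + 1 < w.count (!x) := by simpa [List.count_cons] using h
        obtain ⟨u, r, rfl⟩ := ih _ (by simp) w (by omega) rfl
        have h2 : r.count x < r.count (!x) := by
          simp only [List.count_append, count_excursion, List.count_cons] at h1
          simp at h1
          omega
        obtain ⟨v, r, rfl⟩ := ih _ (by simp; omega) r h2 rfl
        exact ⟨node () u v, r, by simp [excursion]⟩
      · exact ⟨nil, w, rfl⟩

/-- The word of a sequence of blocks `(s, t)`: a Dyck path below the axis with tree `s`, followed by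
an arch above the axis around the Dyck path with tree `t`. -/
def word : List (BinaryTree Unit × BinaryTree Unit) → List Bool
  | [] => []
  | (s, t) :: l => excursion false s ++ true :: (excursion true t ++ false :: word l)

/-- The number of cars, and of spots, of a sequence of blocks. -/
def size : List (BinaryTree Unit × BinaryTree Unit) → ℕ
  | [] => 0
  | (s, t) :: l => s.numNodes + t.numNodes + 1 + size l

theorem count_word (x : Bool) (l : List (BinaryTree Unit × BinaryTree Unit)) :
    (word l).count x = size l := by
  induction l with
  | nil => rfl
  | cons p l ih =>
    simp only [word, size, List.count_cons, List.count_append, count_excursion, ih]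
    cases x <;> simp <;> omega

theorem word_injective : Function.Injective word := by
  intro l
  induction l with
  | nil =>
    intro l' h
    match l' with
    | [] => rfl
    | (s, t) :: l' => simp [word] at h
  | cons p l ih =>
    intro l' h
    match l' with
    | [] => simp [word] at h
    | (s, t) :: l' =>
      obtain ⟨h1, h⟩ := excursion_append_inj (b := false) h
      obtain ⟨h2, h⟩ := excursion_append_inj (b := true) h
      rw [ih h, ← h1, ← h2]

/-- A balanced word that is empty or ends with `false` is a sequence of blocks: before its last
letter a nonempty one is above the axis, so it rises above the axis for a first time, and it
returns to the axis afterwards. -/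
theorem exists_word_eq (w : List Bool) (h : w.count true = w.count false)
    (hw : w = [] ∨ ∃ v, w = v ++ [false]) : ∃ l, word l = w := by
  induction hn : w.length using Nat.strong_induction_on generalizing w with
  | _ n ih =>
    subst hn
    rcases hw with rfl | ⟨v, rfl⟩
    · exact ⟨[], rfl⟩
    · obtain ⟨s, r, rfl⟩ := exists_excursion_append (b := false) v (by simp at h ⊢; omega)
      have h1 : (r ++ [false]).count true < (r ++ [false]).count (!true) := by
        simp [count_excursion] at h ⊢
        omega
      obtain ⟨t, r', hr⟩ := exists_excursion_append (b := true) _ h1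
      have h2 : r'.count true = r'.count false := by
        have e1 := congrArg (List.count true) hr
        have e2 := congrArg (List.count false) hr
        simp [count_excursion] at h e1 e2
        omega
      have h3 : r' = [] ∨ ∃ v, r' = v ++ [false] := by
        rcases List.eq_nil_or_concat' r' with h0 | ⟨v, x, rfl⟩
        · exact Or.inl h0
        · right
          refine ⟨v, ?_⟩
          have := congrArg List.getLast? hr
          simp [List.getLast?_append, List.getLast?_cons] at this
          rw [← this]
      obtain ⟨l, rfl⟩ := ih r'.length (by
        have := congrArg List.length hr
        simp at this ⊢
        omega) r' h2 h3 rfl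
      exact ⟨(s, t) :: l, by simp [word] at hr ⊢; exact hr.symm⟩

theorem lt_of_mem_cars_word {l : List (BinaryTree Unit × BinaryTree Unit)} {c p : ℕ}
    (h : p ∈ cars c (word l)) : p < c + size l := by
  induction l generalizing c with
  | nil => simp [word, cars] at h
  | cons q l ih =>
    have e : word (q :: l) =
        (excursion false q.1 ++ true :: excursion true q.2) ++ false :: word l := by simp [word]
    rw [e, cars_append, List.mem_append] at h
    simp only [size]
    rcases h with h | h
    · have := le_add_count_of_mem_cars h
      simp [count_excursion] at this
      omega
    · have := ih h
      simp [count_excursion] at this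
      omega

/-- The ascending preferences of length `n` are the ones encoded by block sequences of size `n`. -/
theorem exists_cars_word_iff {n : ℕ} {a : List ℕ} :
    (∃ l, size l = n ∧ cars 1 (word l) = a) ↔ IsPreference n a ∧ a.Pairwise (· ≤ ·) := by
  constructor
  · rintro ⟨l, rfl, rfl⟩
    refine ⟨⟨by rw [length_cars, count_word], fun p hp => ⟨le_of_mem_cars hp, ?_⟩⟩,
      pairwise_cars _ _⟩
    have := lt_of_mem_cars_word hp
    omega
  · rintro ⟨⟨hl, hp⟩, ha⟩
    cases n with
    | zero => exact ⟨[], rfl, (List.eq_nil_of_length_eq_zero hl).symm⟩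
    | succ n =>
      obtain ⟨w, rfl, hc⟩ := exists_cars_eq n 1 a ha fun p h => by
        have := hp p h
        omega
      rw [length_cars] at hl
      obtain ⟨l, h⟩ := exists_word_eq (w ++ [false]) (by simp [hc] at hl ⊢; omega)
        (Or.inr ⟨w, rfl⟩)
      refine ⟨l, ?_, by rw [h]⟩
      rw [← count_word true, h, hl]

theorem cars_word_injOn (n : ℕ) :
    Set.InjOn (fun l => cars 1 (word l)) {l | size l = n} := by
  intro l hl l' hl' h
  refine word_injective (cars_injective h ?_)
  rw [count_word, count_word, hl, hl']

/-! ### The parking process on a sequence of blocks -/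

theorem parkSpot_eq_some_of_le {n k p d : ℕ} {occ : Finset ℕ} (hd : 1 ≤ d) (hdp : d ≤ p)
    (hk : p ≤ d + k) (hocc : d ∉ occ) (h : ∀ x, d < x → x ≤ p → x ∈ occ) :
    parkSpot n k occ p = some d := by
  unfold parkSpot candidates
  rw [List.find?_append]
  have : List.find? (fun s => decide (s ∉ occ))
      (List.filter (fun s => decide (1 ≤ s)) (List.map (fun j => p - j) (List.range (k + 1)))) =
      some d := by
    rw [List.find?_filter, List.find?_map, Option.map_eq_some_iff]
    refine ⟨p - d, ?_, Nat.sub_sub_self hdp⟩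
    rw [List.find?_range_eq_some]
    refine ⟨?_, by rw [List.mem_range]; omega, ?_⟩
    · simp [Nat.sub_sub_self hdp, hd, hocc]
    · intro j hj
      have := h (p - j) (by omega) (by omega)
      simp [this]
  rw [this]
  rfl

theorem parkSpot_eq_some_of_lt {n k p d : ℕ} {occ : Finset ℕ} (hdp : p < d) (hdn : d ≤ n)
    (hocc : d ∉ occ) (h : ∀ x, 1 ≤ x → x < d → x ∈ occ) : parkSpot n k occ p = some d := by
  unfold parkSpot candidates
  rw [List.find?_append, Option.or_eq_some_iff]
  right
  constructor
  · simp only [List.find?_eq_none, List.mem_filter, List.mem_map, List.mem_range]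
    rintro x ⟨⟨j, hj, rfl⟩, hx⟩
    have := h (p - j) (by simpa using hx) (by omega)
    simp [this]
  · rw [List.find?_range'_eq_some]
    refine ⟨by simpa using hocc, by simp; omega, ?_⟩
    intro j h1 h2
    simpa using h j (by omega) h2

theorem of_parkSpot_eq_some {n k p d : ℕ} {occ : Finset ℕ} (h : parkSpot n k occ p = some d) :
    d ∉ occ ∧ 1 ≤ d ∧ p ≤ d + k ∧ (d ≤ p ∨ d ≤ n) := by
  have h1 := List.find?_some h
  have h2 := List.mem_of_find?_eq_some h
  simp only [candidates, List.mem_append, List.mem_filter, List.mem_map, List.mem_range,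
    List.mem_range'_1, decide_eq_true_eq] at h1 h2
  refine ⟨h1, ?_⟩
  rcases h2 with ⟨⟨j, hj, rfl⟩, h2⟩ | h2 <;> omega

/-- The set of occupied spots after the cars with preferences `a` have parked. -/
def run (n k : ℕ) : Finset ℕ → List ℕ → Option (Finset ℕ)
  | occ, [] => some occ
  | occ, p :: a => (parkSpot n k occ p).bind fun d => run n k (insert d occ) a

theorem isSome_run (n k : ℕ) (occ : Finset ℕ) (a : List ℕ) :
    (run n k occ a).isSome = (outcome n k occ a).isSome := by
  induction a generalizing occ with
  | nil => rfl
  | cons p a ih =>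
    unfold run outcome
    cases parkSpot n k occ p with
    | none => rfl
    | some d => simpa using ih (insert d occ)

theorem run_append (n k : ℕ) (occ : Finset ℕ) (a b : List ℕ) :
    run n k occ (a ++ b) = (run n k occ a).bind fun o => run n k o b := by
  induction a generalizing occ with
  | nil => rfl
  | cons p a ih =>
    simp only [List.cons_append, run]
    cases parkSpot n k occ p with
    | none => rfl
    | some d => exact ih _

/-- If all cars can park, then each takes a new spot. -/
theorem card_run {n k : ℕ} {occ o : Finset ℕ} {a : List ℕ} (h : run n k occ a = some o)
    (ha : ∀ p ∈ a, p ≤ n) (hocc : occ ⊆ Finset.Icc 1 n) :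
    o ⊆ Finset.Icc 1 n ∧ o.card = occ.card + a.length := by
  induction a generalizing occ with
  | nil =>
    obtain rfl : occ = o := by simpa [run] using h
    exact ⟨hocc, rfl⟩
  | cons p a ih =>
    obtain ⟨d, hd, h⟩ := Option.bind_eq_some_iff.1 h
    obtain ⟨h1, h2, -, h4⟩ := of_parkSpot_eq_some hd
    have hp := ha p (by simp)
    have := ih h (fun q hq => ha q (List.mem_cons_of_mem _ hq))
      (Finset.insert_subset (Finset.mem_Icc.2 ⟨h2, by omega⟩) hocc)
    rw [Finset.card_insert_of_notMem h1] at this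
    refine ⟨this.1, ?_⟩
    rw [this.2, List.length_cons]
    omega

/-- A free spot stays free if it is out of the reach of all later cars. -/
theorem notMem_run {n k y : ℕ} {occ o : Finset ℕ} {a : List ℕ} (h : run n k occ a = some o)
    (ha : ∀ p ∈ a, y + k < p) (hy : y ∉ occ) : y ∉ o := by
  induction a generalizing occ with
  | nil =>
    obtain rfl : occ = o := by simpa [run] using h
    exact hy
  | cons p a ih =>
    obtain ⟨d, hd, h⟩ := Option.bind_eq_some_iff.1 h
    obtain ⟨-, -, h3, -⟩ := of_parkSpot_eq_some hd
    refine ih h (fun q hq => ha q (List.mem_cons_of_mem _ hq)) ?_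
    have hp := ha p (by simp)
    rw [Finset.mem_insert]
    rintro (rfl | h)
    · omega
    · exact hy h

/-- The letter `true` after a Dyck path below the axis: the car backs up to the free spot `x` that
was passed when the path started. -/
theorem parkSpot_union_Ioc {n k x c : ℕ} {A : Finset ℕ} (hA : ∀ y ∈ A, y < x) (hx : 1 ≤ x)
    (hxc : x ≤ c) (hk : c ≤ x + k) :
    parkSpot n k (A ∪ Finset.Ioc x c) c = some x ∧
      insert x (A ∪ Finset.Ioc x c) = A ∪ Finset.Icc x c := by
  constructor
  · refine parkSpot_eq_some_of_le hx hxc hk ?_ ?_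
    · simp only [Finset.mem_union, Finset.mem_Ioc, lt_irrefl, false_and, or_false]
      exact fun h => lt_irrefl x (hA x h)
    · intro y h1 h2
      simp [h1, h2]
  · rw [Finset.insert_union_distrib, ← Finset.Ioc_insert_left hxc]
    ext y
    simp

theorem lt_of_mem_union_Ioc {A : Finset ℕ} {x c : ℕ} (hA : ∀ y ∈ A, y < x) (hxc : x ≤ c) :
    ∀ y ∈ A ∪ Finset.Ioc x c, y < c + 1 := by
  intro y hy
  rcases Finset.mem_union.1 hy with hy | hy
  · have := hA y hy
    omega
  · have := Finset.mem_Ioc.1 hy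
    omega

theorem union_Ioc_union_Icc (A : Finset ℕ) {x c : ℕ} (hxc : x ≤ c) (m : ℕ) :
    A ∪ Finset.Ioc x c ∪ Finset.Icc (c + 1) (c + 1 + m) = A ∪ Finset.Ioc x (c + 1 + m) := by
  ext y
  simp only [Finset.mem_union, Finset.mem_Ioc, Finset.mem_Icc, or_assoc]
  refine or_congr_right ?_
  omega

/-- During a short Dyck path below the axis, every car parks in the last free spot it has passed,
so that the spots of the path are filled and the earlier free spot `x` remains. -/
theorem run_excursion_false {n k : ℕ} (t : BinaryTree Unit) (ht : t.numNodes ≤ k) {x c : ℕ}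
    {A : Finset ℕ} (hA : ∀ y ∈ A, y < x) (hx : 1 ≤ x) (hxc : x ≤ c) :
    run n k (A ∪ Finset.Ioc x c) (cars c (excursion false t)) =
      some (A ∪ Finset.Ioc x (c + t.numNodes)) := by
  induction t generalizing x c A with
  | nil => rfl
  | node a l r hl hr =>
    simp only [numNodes] at ht
    have hA' := lt_of_mem_union_Ioc hA hxc
    have h1 := hl (by omega) hA' (by omega) le_rfl
    rw [Finset.Ioc_self, Finset.union_empty] at h1
    obtain ⟨h2, h3⟩ := parkSpot_union_Ioc (n := n) (k := k) (x := c + 1) (c := c + 1 + l.numNodes)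
      hA' (by omega) (by omega) (by omega)
    have h4 := union_Ioc_union_Icc A hxc l.numNodes
    have h5 := hr (by omega) hA hx (show x ≤ c + 1 + l.numNodes by omega)
    simp only [excursion, cars, cars_append, count_excursion, Bool.not_false, run_append, h1,
      Option.bind_some, run, h2, h3, h4, h5, numNodes]
    congr 3
    omega

/-- A long Dyck path below the axis leaves a free spot out of the reach of all later cars. -/
theorem exists_notMem_run_excursion_false {n k : ℕ} (t : BinaryTree Unit) {x c : ℕ}
    {A o : Finset ℕ} {b : List ℕ} (hA : ∀ y ∈ A, y < x) (hx : 1 ≤ x) (hxc : x ≤ c)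
    (ht : x + k < c + t.numNodes) (hb : ∀ p ∈ b, c + t.numNodes ≤ p)
    (h : run n k (A ∪ Finset.Ioc x c) (cars c (excursion false t) ++ b) = some o) :
    ∃ y, 1 ≤ y ∧ y < c + t.numNodes ∧ y ∉ o := by
  induction t generalizing x c A b with
  | nil =>
    simp only [numNodes, add_zero] at ht hb ⊢
    refine ⟨x, hx, by omega, notMem_run h (fun p hp => ?_) ?_⟩
    · simp only [excursion, cars, List.nil_append] at hp
      exact ht.trans_le (hb p hp)
    · simp only [Finset.mem_union, Finset.mem_Ioc, lt_irrefl, false_and, or_false]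
      exact fun h => lt_irrefl x (hA x h)
  | node a l r hl hr =>
    simp only [numNodes] at ht hb ⊢
    have hA' := lt_of_mem_union_Ioc hA hxc
    simp only [excursion, cars, cars_append, count_excursion, Bool.not_false, List.append_assoc,
      List.cons_append] at h
    rcases le_or_gt l.numNodes k with hk | hk
    · have h1 := run_excursion_false (n := n) l hk hA' (by omega) le_rfl
      rw [Finset.Ioc_self, Finset.union_empty] at h1
      obtain ⟨h2, h3⟩ := parkSpot_union_Ioc (n := n) (k := k) (x := c + 1)
        (c := c + 1 + l.numNodes) hA' (by omega) (by omega) (by omega)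
      have h4 := union_Ioc_union_Icc A hxc l.numNodes
      rw [run_append, h1, Option.bind_some, run, h2, Option.bind_some, h3, h4] at h
      obtain ⟨y, hy, hy', hyo⟩ := hr hA hx (by omega) (by omega)
        (fun p hp => by have := hb p hp; omega) h
      exact ⟨y, hy, by omega, hyo⟩
    · -- The path of `l` itself is too long; the spot it starts from takes the role of `x`.
      rw [← Finset.union_empty (A ∪ Finset.Ioc x c), ← Finset.Ioc_self (c + 1)] at h
      obtain ⟨y, hy, hy', hyo⟩ := hl hA' (by omega) le_rfl (by omega) (fun p hp => by
        rcases List.mem_cons.1 hp with rfl | hp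
        · exact le_rfl
        · rcases List.mem_append.1 hp with hp | hp
          · exact le_of_mem_cars hp
          · have := hb p hp
            omega) h
      exact ⟨y, hy, by omega, hyo⟩

/-- Above the axis all spots up to some `m ≥ c` are occupied, and each car takes the next one. -/
theorem run_excursion_true {n k : ℕ} (t : BinaryTree Unit) {c m : ℕ} (hcm : c ≤ m)
    (hm : m + t.numNodes ≤ n) :
    run n k (Finset.Icc 1 m) (cars c (excursion true t)) =
      some (Finset.Icc 1 (m + t.numNodes)) := by
  induction t generalizing c m with
  | nil => rfl
  | node a l r hl hr =>
    simp only [numNodes] at hm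
    have h1 : parkSpot n k (Finset.Icc 1 m) c = some (m + 1) :=
      parkSpot_eq_some_of_lt (by omega) (by omega) (by simp) fun x h1 h2 => by
        rw [Finset.mem_Icc]
        omega
    have h2 : insert (m + 1) (Finset.Icc 1 m) = Finset.Icc 1 (m + 1) :=
      Finset.insert_Icc_right_eq_Icc_add_one (by omega)
    have h3 := hl (c := c) (m := m + 1) (by omega) (by omega)
    have h4 := hr (c := c + l.numNodes + 1) (m := m + 1 + l.numNodes) (by omega) (by omega)
    simp only [excursion, cars, cars_append, count_excursion, Bool.not_true, run, h1, h2, h3, h4,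
      Option.bind_some, run_append, numNodes]
    congr 2
    omega

/-- All cars of a block sequence can park if and only if none of its Dyck paths below the axis is
longer than `k`. -/
theorem isSome_run_word {n k : ℕ} (l : List (BinaryTree Unit × BinaryTree Unit)) {q : ℕ}
    (hq : q + size l = n) :
    (run n k (Finset.Icc 1 q) (cars (q + 1) (word l))).isSome ↔
      ∀ p ∈ l, p.1.numNodes ≤ k := by
  induction l generalizing q with
  | nil => simp [word, cars, run]
  | cons p l ih =>
    obtain ⟨s, t⟩ := p
    have hq' := hq
    simp only [size] at hq'
    have hA : ∀ y ∈ Finset.Icc 1 q, y < q + 1 := fun y hy => by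
      have := Finset.mem_Icc.1 hy
      omega
    rcases le_or_gt s.numNodes k with hk | hk
    · have h1 := run_excursion_false (n := n) s hk hA (by omega) le_rfl
      rw [Finset.Ioc_self, Finset.union_empty] at h1
      obtain ⟨h2, h3⟩ := parkSpot_union_Ioc (n := n) (k := k) (x := q + 1)
        (c := q + 1 + s.numNodes) hA (by omega) (by omega) (by omega)
      have h4 : Finset.Icc 1 q ∪ Finset.Icc (q + 1) (q + 1 + s.numNodes) =
          Finset.Icc 1 (q + 1 + s.numNodes) := by
        ext y
        simp only [Finset.mem_union, Finset.mem_Icc]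
        omega
      have h5 := run_excursion_true (n := n) (k := k) t (le_refl (q + 1 + s.numNodes)) (by omega)
      have h6 := ih (q := q + 1 + s.numNodes + t.numNodes) (by omega)
      simp only [word, cars, cars_append, count_excursion, run_append, h1, Option.bind_some, run,
        h2, h3, h4, h5, h6, List.forall_mem_cons, hk, true_and]
    · refine iff_of_false (fun h => ?_) fun h => ?_
      · obtain ⟨o, h⟩ := Option.isSome_iff_exists.1 h
        obtain ⟨h1, h2⟩ := card_run h (fun p hp => by
          have := lt_of_mem_cars_word hp
          omega) (Finset.Icc_subset_Icc le_rfl (by omega))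
        -- As many cars as free spots: if all can park, then no spot stays free.
        obtain rfl : o = Finset.Icc 1 n := Finset.eq_of_subset_of_card_le h1 (by
          rw [h2, length_cars, count_word, Nat.card_Icc, Nat.card_Icc]
          omega)
        simp only [word, cars_append, count_excursion] at h
        rw [← Finset.union_empty (Finset.Icc 1 q), ← Finset.Ioc_self (q + 1)] at h
        obtain ⟨y, hy, hy', hyo⟩ := exists_notMem_run_excursion_false s hA (by omega) le_rfl
          (by omega) (fun p hp => le_of_mem_cars hp) h
        rw [Finset.mem_Icc] at hyo
        omega
      · have := h _ List.mem_cons_self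
        simp only at this
        omega

/-- The block sequences encode the ascending `k`-Naples parking functions. -/
theorem ascending_eq_image (n k : ℕ) :
    ascending n k =
      (fun l => cars 1 (word l)) '' {l | size l = n ∧ ∀ p ∈ l, p.1.numNodes ≤ k} := by
  ext a
  simp only [ascending, IsNaples, Set.mem_ofPred_eq, Set.mem_image, ← isSome_run]
  constructor
  · rintro ⟨⟨h1, h2⟩, h3⟩
    obtain ⟨l, hl, rfl⟩ := exists_cars_word_iff.2 ⟨h1, h3⟩
    exact ⟨l, ⟨hl, (isSome_run_word (q := 0) l (by omega)).1 h2⟩, rfl⟩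
  · rintro ⟨l, ⟨hl, h2⟩, rfl⟩
    obtain ⟨h1, h3⟩ := exists_cars_word_iff.1 ⟨l, hl, rfl⟩
    exact ⟨⟨h1, (isSome_run_word (q := 0) l (by omega)).2 h2⟩, h3⟩

/-- Car `1` prefers spot `1` if and only if the first block starts above the axis. -/
theorem head?_cars_word (l : List (BinaryTree Unit × BinaryTree Unit)) :
    (cars 1 (word l)).head? = some 1 ↔ ∃ t l', l = (nil, t) :: l' := by
  match l with
  | [] => simp [word, cars]
  | (nil, t) :: l => simp [word, excursion, cars]
  | (node a u v, t) :: l =>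
    refine iff_of_false (fun h => ?_) (by simp)
    have h1 : 1 ∈ cars 2 ((excursion false u ++ true :: excursion false v) ++
        true :: (excursion true t ++ false :: word l)) := by
      simpa [word, excursion, cars] using List.mem_of_head? h
    exact absurd (le_of_mem_cars h1) (by omega)

/-! ### Counting block sequences -/

/-- The pairs of trees with `i` nodes in total, at most `k` of them in the first tree. -/
def treePairs (k i : ℕ) : Finset (BinaryTree Unit × BinaryTree Unit) :=
  (antidiagonal i).biUnion fun ij =>
    if ij.1 ≤ k then treesOfNumNodesEq ij.1 ×ˢ treesOfNumNodesEq ij.2 else ∅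

theorem mem_treePairs {k i : ℕ} {p : BinaryTree Unit × BinaryTree Unit} :
    p ∈ treePairs k i ↔ p.1.numNodes + p.2.numNodes = i ∧ p.1.numNodes ≤ k := by
  simp only [treePairs, Finset.mem_biUnion, mem_antidiagonal, Prod.exists]
  constructor
  · rintro ⟨a, b, h, hp⟩
    split_ifs at hp with hk
    · simp only [Finset.mem_product, mem_treesOfNumNodesEq] at hp
      omega
    · simp at hp
  · rintro ⟨h, hk⟩
    exact ⟨_, _, h, by simp [hk]⟩

theorem card_treePairs (k i : ℕ) : (treePairs k i).card =
    ∑ ij ∈ antidiagonal i, (if ij.1 ≤ k then catalan ij.1 else 0) * catalan ij.2 := by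
  rw [treePairs, Finset.card_biUnion]
  · refine Finset.sum_congr rfl fun ij _ => ?_
    split_ifs
    · simp [treesOfNumNodesEq_card_eq_catalan]
    · simp
  · intro x _ y _ hxy
    refine Finset.disjoint_left.2 fun p h1 h2 => hxy ?_
    dsimp only at h1 h2
    split_ifs at h1 h2
    · simp only [Finset.mem_product, mem_treesOfNumNodesEq] at h1 h2
      exact Prod.ext (h1.1.symm.trans h2.1) (h1.2.symm.trans h2.2)
    all_goals simp_all

/-- The set of block sequences of size `n` whose Dyck paths below the axis have semilength at
most `k`. -/
def blockSeqs (k n : ℕ) : Set (List (BinaryTree Unit × BinaryTree Unit)) :=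
  {l | size l = n ∧ ∀ p ∈ l, p.1.numNodes ≤ k}

theorem finite_blockSeqs (k n : ℕ) : (blockSeqs k n).Finite := by
  refine Set.Finite.of_finite_image ?_ ((cars_word_injOn n).mono fun l h => h.1)
  exact (ascending_eq_image n k).symm ▸ finite_ascending n k

/-- The block sequences of size `n + 1` with the bound `k`, except for the first block, for which
the bound is `j`. -/
def consBlockSeqs (j k n : ℕ) : Set (List (BinaryTree Unit × BinaryTree Unit)) :=
  {l | size l = n + 1 ∧ ∃ p l', l = p :: l' ∧ p.1.numNodes ≤ j ∧ ∀ p ∈ l', p.1.numNodes ≤ k}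

theorem ncard_consBlockSeqs (j k n : ℕ) : (consBlockSeqs j k n).ncard =
    ∑ im ∈ antidiagonal n, (treePairs j im.1).card * (blockSeqs k im.2).ncard := by
  classical
  let f (im : ℕ × ℕ) : Finset (List (BinaryTree Unit × BinaryTree Unit)) :=
    (treePairs j im.1 ×ˢ (finite_blockSeqs k im.2).toFinset).image fun x => x.1 :: x.2
  have hf (im : ℕ × ℕ) (l : List (BinaryTree Unit × BinaryTree Unit)) :
      l ∈ f im ↔ ∃ p l', l = p :: l' ∧ (p.1.numNodes + p.2.numNodes = im.1 ∧ p.1.numNodes ≤ j) ∧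
        size l' = im.2 ∧ ∀ p ∈ l', p.1.numNodes ≤ k := by
    simp only [f, Finset.mem_image, Finset.mem_product, mem_treePairs, Set.Finite.mem_toFinset,
      blockSeqs, Set.mem_ofPred_eq, Prod.exists]
    constructor
    · rintro ⟨a, b, l', h, rfl⟩
      exact ⟨a, b, l', rfl, h⟩
    · rintro ⟨a, b, l', rfl, h⟩
      exact ⟨a, b, l', h, rfl⟩
  have h1 : consBlockSeqs j k n = ((antidiagonal n).biUnion f : Finset _) := by
    ext l
    simp only [consBlockSeqs, Set.mem_ofPred_eq, Finset.mem_coe, Finset.mem_biUnion, hf,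
      mem_antidiagonal, Prod.exists]
    constructor
    · rintro ⟨h, a, b, l', rfl, h1, h2⟩
      simp only [size] at h
      exact ⟨a.numNodes + b.numNodes, size l', by omega, a, b, l', rfl, ⟨rfl, h1⟩, rfl, h2⟩
    · rintro ⟨i, m, h, a, b, l', rfl, ⟨h1, h2⟩, h3, h4⟩
      refine ⟨?_, a, b, l', rfl, h2, h4⟩
      simp only [size]
      omega
  rw [h1, Set.ncard_coe_finset, Finset.card_biUnion]
  · refine Finset.sum_congr rfl fun im _ => ?_
    rw [Finset.card_image_of_injective, Finset.card_product,
      ← Set.ncard_eq_toFinset_card _ (finite_blockSeqs k im.2)]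
    intro x y h
    simp only [List.cons.injEq] at h
    exact Prod.ext h.1 h.2
  · intro x _ y _ hxy
    refine Finset.disjoint_left.2 fun l hx hy => hxy ?_
    obtain ⟨p, l', rfl, h1, h2⟩ := (hf x l).1 hx
    obtain ⟨p', l'', h, h3, h4⟩ := (hf y _).1 hy
    obtain ⟨rfl, rfl⟩ := List.cons.inj h
    exact Prod.ext (h1.1.symm.trans h3.1) (h2.1.symm.trans h4.1)

theorem numAscending_eq (n k : ℕ) : numAscending n k = (blockSeqs k n).ncard := by
  rw [numAscending, ascending_eq_image]
  exact ((cars_word_injOn n).mono fun l h => h.1).ncard_image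

theorem numAscending_zero (k : ℕ) : numAscending 0 k = 1 := by
  rw [numAscending_eq, Set.ncard_eq_one]
  refine ⟨[], ?_⟩
  ext l
  match l with
  | [] => simp [blockSeqs, size]
  | (s, t) :: l => simp [blockSeqs, size]

theorem numAscending_succ (n k : ℕ) : numAscending (n + 1) k =
    ∑ im ∈ antidiagonal n, (treePairs k im.1).card * numAscending im.2 k := by
  simp only [numAscending_eq, ← ncard_consBlockSeqs]
  congr 1
  ext l
  match l with
  | [] => simp [blockSeqs, consBlockSeqs, size]
  | p :: l =>
    simp only [blockSeqs, consBlockSeqs, Set.mem_ofPred_eq, List.forall_mem_cons, List.cons.injEq]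
    refine and_congr_right fun _ => ⟨fun h => ⟨_, _, ⟨rfl, rfl⟩, h⟩, ?_⟩
    rintro ⟨_, _, ⟨rfl, rfl⟩, h⟩
    exact h

theorem numAscendingOne_zero (k : ℕ) : numAscendingOne 0 k = 0 := by
  rw [numAscendingOne, Set.ncard_eq_zero (finite_ascendingOne 0 k)]
  refine Set.eq_empty_of_forall_notMem fun a ⟨⟨⟨⟨h, _⟩, _⟩, _⟩, h'⟩ => ?_
  simp [List.eq_nil_of_length_eq_zero h] at h'

theorem numAscendingOne_succ (n k : ℕ) : numAscendingOne (n + 1) k =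
    ∑ im ∈ antidiagonal n, (treePairs 0 im.1).card * numAscending im.2 k := by
  simp only [numAscending_eq, ← ncard_consBlockSeqs]
  have h : ascendingOne (n + 1) k = (fun l => cars 1 (word l)) '' consBlockSeqs 0 k n := by
    ext a
    simp only [ascendingOne, ascending_eq_image, Set.mem_ofPred_eq]
    constructor
    · rintro ⟨⟨l, ⟨h1, h2⟩, rfl⟩, h⟩
      obtain ⟨t, l', rfl⟩ := (head?_cars_word l).1 h
      exact ⟨_, ⟨h1, _, _, rfl, le_rfl, (List.forall_mem_cons.1 h2).2⟩, rfl⟩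
    · rintro ⟨_, ⟨h1, ⟨s, t⟩, l', rfl, h2, h3⟩, rfl⟩
      cases s with
      | nil =>
        exact ⟨⟨_, ⟨h1, List.forall_mem_cons.2 ⟨Nat.zero_le _, h3⟩⟩, rfl⟩,
          (head?_cars_word _).2 ⟨_, _, rfl⟩⟩
      | node a u v => simp [numNodes] at h2
  rw [numAscendingOne, h]
  exact ((cars_word_injOn (n + 1)).mono fun l h => h.1).ncard_image

/-! ### Generating functions -/

open PowerSeries

/-- The generating function of the Catalan numbers `C_0, …, C_k`. -/
noncomputable def catalanTrunc (k : ℕ) : ℤ⟦X⟧ :=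
  PowerSeries.mk fun n => if n ≤ k then (catalan n : ℤ) else 0

/-- The generating function of `I_{n,k}` with respect to `n`. -/
noncomputable def ascendingSeries (k : ℕ) : ℤ⟦X⟧ :=
  PowerSeries.mk fun n => (numAscending n k : ℤ)

/-- The generating function of `U_{n,k}` with respect to `n`. -/
noncomputable def ascendingOneSeries (k : ℕ) : ℤ⟦X⟧ :=
  PowerSeries.mk fun n => (numAscendingOne n k : ℤ)

/-- The generating function of all Catalan numbers. -/
noncomputable def catalanFull : ℤ⟦X⟧ := PowerSeries.mk fun n => (catalan n : ℤ)

theorem coeff_catalanTrunc_mul (k i : ℕ) :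
    coeff i (catalanTrunc k * catalanFull) = ((treePairs k i).card : ℤ) := by
  simp only [catalanTrunc, catalanFull, coeff_mul, coeff_mk, card_treePairs]
  push_cast
  rfl

theorem coeff_catalanTrunc_mul_ascendingSeries (j k n : ℕ) :
    coeff n (catalanTrunc j * catalanFull * ascendingSeries k) =
      ((∑ im ∈ antidiagonal n, (treePairs j im.1).card * numAscending im.2 k : ℕ) : ℤ) := by
  rw [coeff_mul]
  simp only [coeff_catalanTrunc_mul, ascendingSeries, coeff_mk]
  push_cast
  rfl

theorem ascendingSeries_eq (k : ℕ) :
    ascendingSeries k = 1 + X * (catalanTrunc k * catalanFull * ascendingSeries k) := by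
  ext n
  cases n with
  | zero => simp [ascendingSeries, numAscending_zero]
  | succ n =>
    rw [map_add, coeff_succ_X_mul, coeff_catalanTrunc_mul_ascendingSeries, ← numAscending_succ]
    simp [ascendingSeries, coeff_one]

theorem catalanTrunc_zero : catalanTrunc 0 = 1 := by
  ext n
  cases n <;> simp [catalanTrunc, coeff_one]

theorem catalanTrunc_succ (k : ℕ) : catalanTrunc (k + 1) =
    catalanTrunc k + C (catalan (k + 1) : ℤ) * X ^ (k + 1) := by
  ext n
  rw [map_add, coeff_C_mul_X_pow]
  simp only [catalanTrunc, coeff_mk]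
  rcases lt_trichotomy n (k + 1) with h | rfl | h
  · simp [h.ne, h.le, Nat.lt_succ_iff.1 h]
  · simp
  · simp [h.ne', h.not_ge, (Nat.lt_of_succ_lt h).not_ge]

theorem ascendingOneSeries_eq (k : ℕ) :
    ascendingOneSeries k = X * (catalanFull * ascendingSeries k) := by
  rw [← one_mul catalanFull, ← catalanTrunc_zero]
  ext n
  cases n with
  | zero => simp [ascendingOneSeries, numAscendingOne_zero]
  | succ n =>
    rw [coeff_succ_X_mul, coeff_catalanTrunc_mul_ascendingSeries, ← numAscendingOne_succ]
    simp [ascendingOneSeries]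

theorem ascendingSeries_succ (k : ℕ) : ascendingSeries (k + 1) = ascendingSeries k +
    C (catalan (k + 1) : ℤ) * (X ^ (k + 1) * (ascendingSeries k * ascendingOneSeries (k + 1))) := by
  have h1 := ascendingSeries_eq k
  have h2 := ascendingSeries_eq (k + 1)
  rw [catalanTrunc_succ] at h2
  rw [ascendingOneSeries_eq]
  linear_combination ascendingSeries k * h2 - ascendingSeries (k + 1) * h1

theorem ascendingOneSeries_succ (k : ℕ) : ascendingOneSeries (k + 1) = ascendingOneSeries k +
    C (catalan (k + 1) : ℤ) *
      (X ^ (k + 1) * (ascendingOneSeries k * ascendingOneSeries (k + 1))) := by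
  have h := ascendingSeries_succ k
  have h1 := ascendingOneSeries_eq k
  have h2 := ascendingOneSeries_eq (k + 1)
  generalize ascendingOneSeries (k + 1) = V at *
  rw [h1]
  linear_combination h2 + X * catalanFull * h

theorem coeff_C_mul_X_pow_mul_mul (c : ℤ) (k n : ℕ) (f g : ℕ → ℤ) :
    coeff n (C c * (X ^ k * (PowerSeries.mk f * PowerSeries.mk g))) =
      c * ∑ i ∈ Finset.range (n + 1 - k), f i * g (n - k - i) := by
  rw [coeff_C_mul, coeff_X_pow_mul']
  split_ifs with h
  · rw [coeff_mul, Finset.Nat.sum_antidiagonal_eq_sum_range_succ_mk, Nat.succ_eq_add_one,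
      Nat.sub_add_comm h]
    simp
  · simp [show n + 1 - k = 0 by omega]

end Naples

theorem theorem5p1 (n k : ℕ) (hk : 1 ≤ k) :
    Naples.numAscending n k = Naples.numAscending n (k - 1) +
      catalan k * ∑ i ∈ Finset.range (n + 1 - k),
        Naples.numAscending i (k - 1) * Naples.numAscendingOne (n - k - i) k ∧
    Naples.numAscendingOne n k = Naples.numAscendingOne n (k - 1) +
      catalan k * ∑ i ∈ Finset.range (n + 1 - k),
        Naples.numAscendingOne i (k - 1) * Naples.numAscendingOne (n - k - i) k := by
  obtain ⟨k, rfl⟩ := Nat.exists_eq_add_of_le' hk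
  have h1 := congrArg (PowerSeries.coeff n) (Naples.ascendingSeries_succ k)
  have h2 := congrArg (PowerSeries.coeff n) (Naples.ascendingOneSeries_succ k)
  simp only [Naples.ascendingSeries, Naples.ascendingOneSeries, map_add, PowerSeries.coeff_mk,
    Naples.coeff_C_mul_X_pow_mul_mul] at h1 h2
  exact ⟨by exact_mod_cast h1, by exact_mod_cast h2⟩
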